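/- **Theorem (Typing ensures update consistency).** Consider the session $\pi$-calculus with located processes $l^{h}[P]$ and update processes $l\{(\mathsf X).P\}$, defined as follows; here $h\in\mathbb Z$ is a run-time annotation, $k$ is a session variable $x$ or a polarized channel $\kappa^p$ ($p\in\{+,-\}$, $\overline{+}=-$, $\overline{-}=+$), and processes are taken up to renaming of bound names: $$P ::= \mathbf 0 \mid P\,|\,Q \mid (\nu\kappa)P \mid \mathsf{acc}\,a(x).P \mid {!}\mathsf{acc}\,a(x).P \mid \mathsf{req}\,a(x).P \mid l^{h}[P] \mid \mathsf X \mid l\{(\mathsf X).P\} \mid k\langle\tilde e\rangle.P \mid k(\tilde x).P \mid k\langle\!\langle k'\rangle\!\rangle.P \mid k(\!(x)\!).P \mid k\triangleright\{n_i{:}P_i\}_{1\le i\le m} \mid k\triangleleft n;P \mid \mathsf{if}\ e\ \mathsf{then}\ P\ \mathsf{else}\ Q \mid \mathsf{close}(k).P$$ with $m\ge 1$. *Structural congruence* $\equiv$ is the least congruence making $|$ a commutative monoid with unit $\mathbf 0$ and containing $(\nu\kappa)\mathbf 0\equiv\mathbf 0$, $(\nu\kappa)(\nu\kappa')P\equiv(\nu\kappa')(\nu\kappa)P$,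 $(\nu\kappa)P\,|\,Q\equiv(\nu\kappa)(P\,|\,Q)$ for $\kappa$ not free in $Q$, and $l^h[(\nu\kappa)P]\equiv(\nu\kappa)l^h[P]$. *Reduction.* Contexts are $C ::= \bullet \mid l^{h}[C\,|\,P]$; $C^{+},C^{++},C^{-},C^{--}$ denote $C$ with $1,2,-1,-2$ added to all annotations on the path to the hole. Reduction $\to$ is the closure under $\equiv$, $\cdot\,|\,Q$ and $(\nu\kappa)\,\cdot$ of the rules - $E\{C\{\mathsf{acc}\,a(x).P\}|D\{\mathsf{req}\,a(y).Q\}\}\to E^{++}\{(\nu\kappa)(C^{+}\{P\{\kappa^+/x\}\}|D^{+}\{Q\{\kappa^- /y\}\})\}$ with $\kappa$ fresh, and the same for ${!}\mathsf{acc}\,a(x).P$, which is kept in parallel with $P\{\kappa^+/x\}$; - (update) $E\{C\{l^{0}[Q]\}|D\{l\{(\mathsf X).P\}\}\}\to E\{C\{P\{Q/\mathsf X\}\}|D\{\mathbf 0\}\}$; - $E\{C\{\kappa^p\langle\tilde e\rangle.P\}|D\{\kappa^{\overline p}(\tilde x).Q\}\}\to E\{C\{P\}|D\{Q\{\tilde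 c/\tilde x\}\}\}$ if $\tilde e$ evaluates to $\tilde c$; - $E\{C\{\kappa^p\langle\!\langle \kappa'^q\rangle\!\rangle.P\}|D\{\kappa^{\overline p}(\!(x)\!).Q\}\}\to E\{C^{-}\{P\}|D^{+}\{Q\{\kappa'^q/x\}\}\}$; - $E\{C\{\kappa^p\triangleright\{n_i{:}P_i\}_{i}\}|D\{\kappa^{\overline p}\triangleleft n_j;Q\}\}\to E\{C\{P_j\}|D\{Q\}\}$; - $E\{C\{\mathsf{close}(\kappa^p).P\}|D\{\mathsf{close}(\kappa^{\overline p}).Q\}\}\to E^{--}\{C^{-}\{P\}|D^{-}\{Q\}\}$; - $C\{\mathsf{if}\ e\ \mathsf{then}\ P\ \mathsf{else}\ Q\}\to C\{P\}$ if $e$ evaluates to true, and $\to C\{Q\}$ if $e$ evaluates to false. $\to_{\mathrm{upd}}$ is the closure under $\equiv$, $\cdot\,|\,Q$ and $(\nu\kappa)\,\cdot$ of the update rule alone. *Typing.* Session types are $\alpha::={!}(\tilde\tau).\alpha\mid{?}(\tilde\tau).\alpha\mid{!}(\beta).\alpha\mid{?}(\beta).\alpha\mid\&\{n_i:\alpha_i\}_i\mid\oplus\{n_i:\alpha_i\}_i\mid\epsilon$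 with basic types $\tau$, distinct labels, and the usual duality $\overline{\alpha}$. An interface $I$ gives a multiplicity in $\mathbb N\cup\{\infty\}$ to finitely many pairs $a:\alpha$; interfaces are added ($\uplus$) and compared ($\sqsubseteq$) pointwise. $\Gamma$ gives basic types to value variables and pairs $\langle\alpha_q,\overline\alpha_{q'}\rangle$, $q,q'\in\{\mathsf{lin},\mathsf{un}\}$, to service names; $\Theta$ gives interfaces to process variables and locations. A typing $\Delta$ is a finite set of assignments $k:\alpha$ (at most one for each $k$) and bracketed assignments $[\kappa^p:\alpha]$ for distinct restricted channels; $|\Delta|$ is the number of its assignments of both sorts, and $,$ and $\cup$ below are disjoint. The judgment $\Gamma;\Theta\vdash P\triangleright\Delta;I$ is inductively defined by: - $\mathbf 0\triangleright\emptyset;\emptyset$; $\ \mathsf X\triangleright\emptyset;\Theta(\mathsf X)$; if $P_i\triangleright\Delta_i;I_i$ for $i=1,2$, then $P_1|P_2\triangleright\Delta_1\cup\Delta_2;I_1\uplus I_2$; - if $P\triangleright\Delta,x:\alpha;I$ and $\Gamma(a)=\langle\alpha_{\mathsf{lin}},\overline\alpha_{\mathsf{lin}}\rangle$, then $\mathsf{acc}\,a(x).P\triangleright\Delta;I\uplus\langle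 a:\alpha,1\rangle$; if $P\triangleright\Delta,x:\overline\alpha;I$ and $\Gamma(a)=\langle\alpha_q,\overline\alpha_{\mathsf{lin}}\rangle$, then $\mathsf{req}\,a(x).P\triangleright\Delta;I\uplus\langle a:\overline\alpha,1\rangle$; if $P\triangleright x:\alpha;I$ and $\Gamma(a)=\langle\alpha_{\mathsf{un}},\overline\alpha_{\mathsf{lin}}\rangle$, then ${!}\mathsf{acc}\,a(x).P\triangleright\emptyset;\infty\cdot I\uplus\langle a:\alpha,\infty\rangle$; - if $P\triangleright\Delta;I'$, $h=|\Delta|$ and $I'\sqsubseteq\Theta(l)$, then $l^{h}[P]\triangleright\Delta;I'$; if $\Gamma;\Theta,\mathsf X:\Theta(l)\vdash P\triangleright\emptyset;I'$, then $l\{(\mathsf X).P\}\triangleright\emptyset;\emptyset$; - if $P\triangleright\Delta,k:\alpha;I$ and $\Gamma\vdash\tilde e:\tilde\tau$, then $k\langle\tilde e\rangle.P\triangleright\Delta,k:{!}(\tilde\tau).\alpha;I$; if $\Gamma,\tilde x:\tilde\tau;\Theta\vdash P\triangleright\Delta,k:\alpha;I$, then $k(\tilde x).P\triangleright\Delta,k:{?}(\tilde\tau).\alpha;I$;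 - if $P\triangleright\Delta,k:\alpha;I$, then $k\langle\!\langle k'\rangle\!\rangle.P\triangleright\Delta,k:{!}(\beta).\alpha,k':\beta;I$; if $P\triangleright\Delta,k:\alpha,x:\beta;I$, then $k(\!(x)\!).P\triangleright\Delta,k:{?}(\beta).\alpha;I$; - if $P_i\triangleright\Delta,k:\alpha_i;I_i$ and $I_i\sqsubseteq I$ for all $i$, then $k\triangleright\{n_i{:}P_i\}_i\triangleright\Delta,k:\&\{n_i:\alpha_i\}_i;I$; if $P\triangleright\Delta,k:\alpha_j;I$, then $k\triangleleft n_j;P\triangleright\Delta,k:\oplus\{n_i:\alpha_i\}_i;I$; - if $\Gamma\vdash e:\mathsf{bool}$, $P\triangleright\Delta;I_1$, $Q\triangleright\Delta;I_2$ and $I_1,I_2\sqsubseteq I$, then $\mathsf{if}\ e\ \mathsf{then}\ P\ \mathsf{else}\ Q\triangleright\Delta;I$; if $P\triangleright\Delta;I$ and $k\notin\mathrm{dom}\,\Delta$, then $\mathsf{close}(k).P\triangleright\Delta,k:\epsilon;I$; - if $P\triangleright\Delta,\kappa^-:\alpha,\kappa^+:\overline\alpha;I$, then $(\nu\kappa)P\triangleright\Delta,[\kappa^-:\alpha],[\kappa^+:\overline\alpha];I$;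 if $P\triangleright\Delta;I$ and $\kappa^+,\kappa^-\notin\mathrm{dom}\,\Delta$, then $(\nu\kappa)P\triangleright\Delta;I$. $\Delta$ is *balanced* if $\kappa^p:\alpha\in\Delta$ implies $\kappa^{\overline p}:\overline\alpha\in\Delta$, and likewise for bracketed assignments. *Consistency.* A process *contains a $\kappa$-redex* if, enclosed only in locations, parallel compositions and restrictions, it has two parallel subprocesses that are prefixed on $\kappa^p$ and on $\kappa^{\overline p}$, respectively, by complementary actions: output and input of tuples of equal length, delegation and reception of a session, selection of a label and branching that offers it, or closing and closing. A process $P$ is *update-consistent* if for all $P'$ and $\kappa$ such that $P\to^{*}P'$ and $P'$ contains a $\kappa$-redex, if $P'\to_{\mathrm{upd}}P''$ then $P''$ contains a $\kappa$-redex. Here $\kappa$ may be free or restricted. As restricted names can be renamed, for these it is required that a redex on some restricted channel remains, and moreover that the same channel keeps a redex: whenever $P\to^{*}P'\equiv(\nu\kappa_1)\cdots(\nu\kappa_n)R$, the process $R$ contains a $\kappa$-redex with $\kappa$ free in $R$, and $R\to_{\mathrm{upd}}R''$, then $R''$ contains a $\kappa$-redex. **Claim.** If $\Gamma;\Theta\vdash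 P\triangleright\Delta;I$ with $\Delta$ balanced, then $P$ is update-consistent. -/

import Mathlib

/-!
A session pi-calculus with located processes and update processes, its reduction semantics
and its session type system.

Binding is represented by de Bruijn indices, so that alpha-equivalent processes are equal.
There are four independent index spaces: session variables (bound by session acceptance,
session request and session reception), value variables (bound by value reception),
session channels (bound by restriction) and process variables (bound by update processes).
Service names, labels and locations are never bound; they are natural numbers.
-/

namespace AdaptableSessions

noncomputable section

/-! ### Expressions -/

/-- Literal constants. -/
inductive Lit where
  | int (z : ℤ)
  | bool (b : Bool)
  | str (s : String)

/-- Constants: literals, and names standing for values (value variables). -/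
inductive Const where
  | lit (c : Lit)
  | name (i : ℕ)

inductive BinOp where
  | add | sub | mul | le | eq | and | or

inductive Expr where
  | const (c : Const)
  | bin (o : BinOp) (e₁ e₂ : Expr)

/-- The (partial) meaning of the operators on literals. -/
def BinOp.eval : BinOp → Lit → Lit → Option Lit
  | .add, .int x, .int y => some (.int (x + y))
  | .sub, .int x, .int y => some (.int (x - y))
  | .mul, .int x, .int y => some (.int (x * y))
  | .le, .int x, .int y => some (.bool (decide (x ≤ y)))
  | .eq, .int x, .int y => some (.bool (decide (x = y)))
  | .eq, .bool x, .bool y => some (.bool (decide (x = y)))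
  | .eq, .str x, .str y => some (.bool (decide (x = y)))
  | .and, .bool x, .bool y => some (.bool (x && y))
  | .or, .bool x, .bool y => some (.bool (x || y))
  | _, _, _ => none

/-- The evaluation relation `e ↓ c`. -/
inductive Eval : Expr → Const → Prop where
  | const (c : Const) : Eval (.const c) c
  | bin {o : BinOp} {e₁ e₂ : Expr} {c₁ c₂ c : Lit} :
      Eval e₁ (.lit c₁) → Eval e₂ (.lit c₂) → o.eval c₁ c₂ = some c →
      Eval (.bin o e₁ e₂) (.lit c)

/-! ### Processes -/

/-- Polarities of the two endpoints of a session channel. -/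
inductive Pol where
  | pos | neg

def Pol.dual : Pol → Pol
  | .pos => .neg
  | .neg => .pos

/-- The session subjects `k`: a session variable `x` or a polarized channel `κ^p`. -/
inductive Sess where
  | svar (i : ℕ)
  | chan (p : Pol) (i : ℕ)

inductive Proc where
  /-- inactive process -/
  | nil
  /-- parallel composition -/
  | par (P Q : Proc)
  /-- restriction of a session channel (binds channel `0`) -/
  | res (P : Proc)
  /-- session acceptance on service `a` (binds session variable `0`) -/
  | accept (a : ℕ) (P : Proc)
  /-- replicated session acceptance on service `a` (binds session variable `0`) -/
  | repAccept (a : ℕ) (P : Proc)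
  /-- session request on service `a` (binds session variable `0`) -/
  | request (a : ℕ) (P : Proc)
  /-- located process `l^h[P]`; the integer `h` is the run-time annotation -/
  | loc (l : ℕ) (h : ℤ) (P : Proc)
  /-- process variable -/
  | pvar (X : ℕ)
  /-- update process for location `l` (binds process variable `0`) -/
  | adapt (l : ℕ) (P : Proc)
  /-- output of a tuple of expressions -/
  | send (k : Sess) (es : List Expr) (P : Proc)
  /-- input of an `n`-tuple (binds value variables `0, …, n - 1`) -/
  | recv (k : Sess) (n : ℕ) (P : Proc)
  /-- delegation of the session endpoint `k'` -/
  | sendSess (k k' : Sess) (P : Proc)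
  /-- reception of a session endpoint (binds session variable `0`) -/
  | recvSess (k : Sess) (P : Proc)
  /-- offer of `m + 1` labelled alternatives -/
  | branch (k : Sess) (m : ℕ) (lab : Fin (m + 1) → ℕ) (P : Fin (m + 1) → Proc)
  /-- selection of a label -/
  | select (k : Sess) (n : ℕ) (P : Proc)
  /-- conditional -/
  | cond (e : Expr) (P Q : Proc)
  /-- session closing -/
  | close (k : Sess) (P : Proc)

/-! ### Substitution -/

/-- A simultaneous substitution of session subjects for session variables, of channels for
channels, and of constants for value variables. -/
structure Sub where
  sess : ℕ → Sess
  chan : ℕ → ℕ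
  val : ℕ → Const

def Sess.sub (σ : Sub) : Sess → Sess
  | .svar i => σ.sess i
  | .chan p i => .chan p (σ.chan i)

def Const.sub (σ : Sub) : Const → Const
  | .lit c => .lit c
  | .name i => σ.val i

def Expr.sub (σ : Sub) : Expr → Expr
  | .const c => .const (c.sub σ)
  | .bin o e₁ e₂ => .bin o (e₁.sub σ) (e₂.sub σ)

def Sub.id : Sub := ⟨Sess.svar, fun i => i, Const.name⟩

/-- Weakening by one session variable. -/
def Sub.wkS : Sub := { Sub.id with sess := fun i => .svar (i + 1) }

/-- Weakening by one channel. -/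
def Sub.wkC : Sub := { Sub.id with chan := fun i => i + 1 }

/-- Weakening by `n` value variables. -/
def Sub.wkV (n : ℕ) : Sub := { Sub.id with val := fun i => .name (i + n) }

/-- Exchange of the two innermost channels. -/
def Sub.swapC : Sub :=
  { Sub.id with chan := fun i => if i = 0 then 1 else if i = 1 then 0 else i }

/-- Passing under a binder of a session variable. -/
def Sub.liftS (σ : Sub) : Sub :=
  { σ with sess := fun i => match i with
      | 0 => .svar 0
      | i + 1 => (σ.sess i).sub Sub.wkS }

/-- Passing under a restriction. -/
def Sub.liftC (σ : Sub) : Sub :=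
  { σ with
    sess := fun i => (σ.sess i).sub Sub.wkC
    chan := fun i => match i with
      | 0 => 0
      | i + 1 => σ.chan i + 1 }

/-- Passing under a binder of `n` value variables. -/
def Sub.liftV (n : ℕ) (σ : Sub) : Sub :=
  { σ with val := fun i => if i < n then .name i else (σ.val (i - n)).sub (Sub.wkV n) }

def Proc.sub : Sub → Proc → Proc
  | _, .nil => .nil
  | σ, .par P Q => .par (P.sub σ) (Q.sub σ)
  | σ, .res P => .res (P.sub σ.liftC)
  | σ, .accept a P => .accept a (P.sub σ.liftS)
  | σ, .repAccept a P => .repAccept a (P.sub σ.liftS)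
  | σ, .request a P => .request a (P.sub σ.liftS)
  | σ, .loc l h P => .loc l h (P.sub σ)
  | _, .pvar X => .pvar X
  | σ, .adapt l P => .adapt l (P.sub σ)
  | σ, .send k es P => .send (k.sub σ) (es.map (Expr.sub σ)) (P.sub σ)
  | σ, .recv k n P => .recv (k.sub σ) n (P.sub (σ.liftV n))
  | σ, .sendSess k k' P => .sendSess (k.sub σ) (k'.sub σ) (P.sub σ)
  | σ, .recvSess k P => .recvSess (k.sub σ) (P.sub σ.liftS)
  | σ, .branch k m lab P => .branch (k.sub σ) m lab (fun i => (P i).sub σ)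
  | σ, .select k n P => .select (k.sub σ) n (P.sub σ)
  | σ, .cond e P Q => .cond (e.sub σ) (P.sub σ) (Q.sub σ)
  | σ, .close k P => .close (k.sub σ) (P.sub σ)

/-- Renaming of process variables. -/
def Proc.renP : (ℕ → ℕ) → Proc → Proc
  | _, .nil => .nil
  | f, .par P Q => .par (P.renP f) (Q.renP f)
  | f, .res P => .res (P.renP f)
  | f, .accept a P => .accept a (P.renP f)
  | f, .repAccept a P => .repAccept a (P.renP f)
  | f, .request a P => .request a (P.renP f)
  | f, .loc l h P => .loc l h (P.renP f)
  | f, .pvar X => .pvar (f X)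
  | f, .adapt l P => .adapt l (P.renP fun i => match i with
      | 0 => 0
      | i + 1 => f i + 1)
  | f, .send k es P => .send k es (P.renP f)
  | f, .recv k n P => .recv k n (P.renP f)
  | f, .sendSess k k' P => .sendSess k k' (P.renP f)
  | f, .recvSess k P => .recvSess k (P.renP f)
  | f, .branch k m lab P => .branch k m lab (fun i => (P i).renP f)
  | f, .select k n P => .select k n (P.renP f)
  | f, .cond e P Q => .cond e (P.renP f) (Q.renP f)
  | f, .close k P => .close k (P.renP f)

/-- Capture-avoiding substitution of processes for process variables. -/
def Proc.subP : (ℕ → Proc) → Proc → Proc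
  | _, .nil => .nil
  | θ, .par P Q => .par (P.subP θ) (Q.subP θ)
  | θ, .res P => .res (P.subP fun i => (θ i).sub Sub.wkC)
  | θ, .accept a P => .accept a (P.subP fun i => (θ i).sub Sub.wkS)
  | θ, .repAccept a P => .repAccept a (P.subP fun i => (θ i).sub Sub.wkS)
  | θ, .request a P => .request a (P.subP fun i => (θ i).sub Sub.wkS)
  | θ, .loc l h P => .loc l h (P.subP θ)
  | θ, .pvar X => θ X
  | θ, .adapt l P => .adapt l (P.subP fun i => match i with
      | 0 => .pvar 0
      | i + 1 => (θ i).renP Nat.succ)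
  | θ, .send k es P => .send k es (P.subP θ)
  | θ, .recv k n P => .recv k n (P.subP fun i => (θ i).sub (Sub.wkV n))
  | θ, .sendSess k k' P => .sendSess k k' (P.subP θ)
  | θ, .recvSess k P => .recvSess k (P.subP fun i => (θ i).sub Sub.wkS)
  | θ, .branch k m lab P => .branch k m lab (fun i => (P i).subP θ)
  | θ, .select k n P => .select k n (P.subP θ)
  | θ, .cond e P Q => .cond e (P.subP θ) (Q.subP θ)
  | θ, .close k P => .close k (P.subP θ)

/-- `P{k/x}` for the session variable `x` with index `0`. -/
def Proc.instS (k : Sess) (P : Proc) : Proc :=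
  P.sub { Sub.id with sess := fun i => match i with
      | 0 => k
      | i + 1 => .svar i }

/-- `P{κ^p/x}` for the session variable `x` with index `0` and a new channel `κ`, which gets
the channel index `0`; the other channels are weakened. -/
def Proc.instNew (p : Pol) (P : Proc) : Proc :=
  P.sub { Sub.id with
    sess := fun i => match i with
      | 0 => .chan p 0
      | i + 1 => .svar i
    chan := fun i => i + 1 }

/-- `P{c₁,…,cₙ/x₁,…,xₙ}` for the value variables with indices `0, …, n - 1`. -/
def Proc.instV (cs : List Const) (P : Proc) : Proc :=
  P.sub { Sub.id with val := fun i => cs.getD i (.name (i - cs.length)) }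

/-- `P{Q/X}` for the process variable `X` with index `0`. -/
def Proc.instP (P Q : Proc) : Proc :=
  P.subP fun i => match i with
    | 0 => Q
    | i + 1 => .pvar i

/-! ### Structural congruence -/

/-- Structural congruence: the least congruence that makes parallel composition a commutative
monoid and allows the usual laws of restriction, including scope extrusion over parallel
composition and over (transparent) locations. -/
inductive Cong : Proc → Proc → Prop where
  | refl (P : Proc) : Cong P P
  | symm {P Q : Proc} : Cong P Q → Cong Q P
  | trans {P Q R : Proc} : Cong P Q → Cong Q R → Cong P R
  | parComm (P Q : Proc) : Cong (.par P Q) (.par Q P)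
  | parAssoc (P Q R : Proc) : Cong (.par (.par P Q) R) (.par P (.par Q R))
  | parNil (P : Proc) : Cong (.par P .nil) P
  | resNil : Cong (.res .nil) .nil
  | resSwap (P : Proc) : Cong (.res (.res P)) (.res (.res (P.sub Sub.swapC)))
  | resPar (P Q : Proc) : Cong (.par (.res P) Q) (.res (.par P (Q.sub Sub.wkC)))
  | resLoc (l : ℕ) (h : ℤ) (P : Proc) : Cong (.loc l h (.res P)) (.res (.loc l h P))
  | par {P P' Q Q' : Proc} : Cong P P' → Cong Q Q' → Cong (.par P Q) (.par P' Q')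
  | res {P P' : Proc} : Cong P P' → Cong (.res P) (.res P')
  | accept {P P' : Proc} (a : ℕ) : Cong P P' → Cong (.accept a P) (.accept a P')
  | repAccept {P P' : Proc} (a : ℕ) : Cong P P' → Cong (.repAccept a P) (.repAccept a P')
  | request {P P' : Proc} (a : ℕ) : Cong P P' → Cong (.request a P) (.request a P')
  | loc {P P' : Proc} (l : ℕ) (h : ℤ) : Cong P P' → Cong (.loc l h P) (.loc l h P')
  | adapt {P P' : Proc} (l : ℕ) : Cong P P' → Cong (.adapt l P) (.adapt l P')
  | send {P P' : Proc} (k : Sess) (es : List Expr) :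
      Cong P P' → Cong (.send k es P) (.send k es P')
  | recv {P P' : Proc} (k : Sess) (n : ℕ) : Cong P P' → Cong (.recv k n P) (.recv k n P')
  | sendSess {P P' : Proc} (k k' : Sess) :
      Cong P P' → Cong (.sendSess k k' P) (.sendSess k k' P')
  | recvSess {P P' : Proc} (k : Sess) : Cong P P' → Cong (.recvSess k P) (.recvSess k P')
  | branch (k : Sess) (m : ℕ) (lab : Fin (m + 1) → ℕ) {P P' : Fin (m + 1) → Proc} :
      (∀ i, Cong (P i) (P' i)) → Cong (.branch k m lab P) (.branch k m lab P')
  | select {P P' : Proc} (k : Sess) (n : ℕ) :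
      Cong P P' → Cong (.select k n P) (.select k n P')
  | cond {P P' Q Q' : Proc} (e : Expr) :
      Cong P P' → Cong Q Q' → Cong (.cond e P Q) (.cond e P' Q')
  | close {P P' : Proc} (k : Sess) : Cong P P' → Cong (.close k P) (.close k P')

/-! ### Reduction -/

/-- Contexts `C ::= • | l^h[C ∣ P]`. -/
inductive Ctx where
  | hole
  | loc (l : ℕ) (h : ℤ) (C : Ctx) (P : Proc)

def Ctx.fill : Ctx → Proc → Proc
  | .hole, Q => Q
  | .loc l h C P, Q => .loc l h (.par (C.fill Q) P)

/-- Addition of `d` to all annotations on the path to the hole: `C⁺`, `C⁺⁺`, `C⁻`, `C⁻⁻` are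
`C.bump 1`, `C.bump 2`, `C.bump (-1)`, `C.bump (-2)`. -/
def Ctx.bump (d : ℤ) : Ctx → Ctx
  | .hole => .hole
  | .loc l h C P => .loc l (h + d) (C.bump d) P

/-- Weakening of a context by a channel. -/
def Ctx.wkC : Ctx → Ctx
  | .hole => .hole
  | .loc l h C P => .loc l h C.wkC (P.sub Sub.wkC)

/-- The update rule. -/
inductive UpdRule : Proc → Proc → Prop where
  | upd (E C D : Ctx) (l : ℕ) (P Q : Proc) :
      UpdRule (E.fill (.par (C.fill (.loc l 0 Q)) (D.fill (.adapt l P))))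
        (E.fill (.par (C.fill (P.instP Q)) (D.fill .nil)))

/-- The other reduction rules. -/
inductive CommRule : Proc → Proc → Prop where
  | opn (E C D : Ctx) (a : ℕ) (P Q : Proc) :
      CommRule (E.fill (.par (C.fill (.accept a P)) (D.fill (.request a Q))))
        ((E.bump 2).fill (.res (.par ((C.wkC.bump 1).fill (P.instNew .pos))
          ((D.wkC.bump 1).fill (Q.instNew .neg)))))
  | ropn (E C D : Ctx) (a : ℕ) (P Q : Proc) :
      CommRule (E.fill (.par (C.fill (.repAccept a P)) (D.fill (.request a Q))))
        ((E.bump 2).fill (.res (.par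
          ((C.wkC.bump 1).fill (.par (P.instNew .pos) ((Proc.repAccept a P).sub Sub.wkC)))
          ((D.wkC.bump 1).fill (Q.instNew .neg)))))
  | io (E C D : Ctx) (p : Pol) (i n : ℕ) (es : List Expr) (cs : List Const) (P Q : Proc) :
      List.Forall₂ Eval es cs → cs.length = n →
      CommRule
        (E.fill (.par (C.fill (.send (.chan p i) es P)) (D.fill (.recv (.chan p.dual i) n Q))))
        (E.fill (.par (C.fill P) (D.fill (Q.instV cs))))
  | pass (E C D : Ctx) (p q : Pol) (i j : ℕ) (P Q : Proc) :
      CommRule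
        (E.fill (.par (C.fill (.sendSess (.chan p i) (.chan q j) P))
          (D.fill (.recvSess (.chan p.dual i) Q))))
        (E.fill (.par ((C.bump (-1)).fill P) ((D.bump 1).fill (Q.instS (.chan q j)))))
  | sel (E C D : Ctx) (p : Pol) (i m : ℕ) (lab : Fin (m + 1) → ℕ) (P : Fin (m + 1) → Proc)
      (j : Fin (m + 1)) (Q : Proc) :
      CommRule
        (E.fill (.par (C.fill (.branch (.chan p i) m lab P))
          (D.fill (.select (.chan p.dual i) (lab j) Q))))
        (E.fill (.par (C.fill (P j)) (D.fill Q)))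
  | close (E C D : Ctx) (p : Pol) (i : ℕ) (P Q : Proc) :
      CommRule
        (E.fill (.par (C.fill (.close (.chan p i) P)) (D.fill (.close (.chan p.dual i) Q))))
        ((E.bump (-2)).fill (.par ((C.bump (-1)).fill P) ((D.bump (-1)).fill Q)))
  | ifTrue (C : Ctx) (e : Expr) (P Q : Proc) :
      Eval e (.lit (.bool true)) → CommRule (C.fill (.cond e P Q)) (C.fill P)
  | ifFalse (C : Ctx) (e : Expr) (P Q : Proc) :
      Eval e (.lit (.bool false)) → CommRule (C.fill (.cond e P Q)) (C.fill Q)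

/-- Closure of a set of reduction rules under structural congruence, parallel composition and
restriction. -/
inductive RedClosure (B : Proc → Proc → Prop) : Proc → Proc → Prop where
  | base {P Q : Proc} : B P Q → RedClosure B P Q
  | str {P P' Q' Q : Proc} : Cong P P' → RedClosure B P' Q' → Cong Q' Q → RedClosure B P Q
  | par {P P' : Proc} (Q : Proc) : RedClosure B P P' → RedClosure B (.par P Q) (.par P' Q)
  | res {P P' : Proc} : RedClosure B P P' → RedClosure B (.res P) (.res P')

/-- Reduction. -/
def Red : Proc → Proc → Prop := RedClosure fun P Q => UpdRule P Q ∨ CommRule P Q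

/-- Update actions: reductions inferred using the update rule. -/
def UpdRed : Proc → Proc → Prop := RedClosure UpdRule

/-! ### Types -/

/-- Basic types. -/
inductive BTy where
  | int | bool | str

/-- Session types. -/
inductive STy where
  | send (τs : List BTy) (α : STy)
  | recv (τs : List BTy) (α : STy)
  | sendSess (β α : STy)
  | recvSess (β α : STy)
  | branch (m : ℕ) (lab : Fin (m + 1) → ℕ) (α : Fin (m + 1) → STy)
  | select (m : ℕ) (lab : Fin (m + 1) → ℕ) (α : Fin (m + 1) → STy)
  | done

/-- Duality. -/
def STy.dual : STy → STy
  | .send τs α => .recv τs α.dual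
  | .recv τs α => .send τs α.dual
  | .sendSess β α => .recvSess β α.dual
  | .recvSess β α => .sendSess β α.dual
  | .branch m lab α => .select m lab (fun i => (α i).dual)
  | .select m lab α => .branch m lab (fun i => (α i).dual)
  | .done => .done

/-- Type qualifiers. -/
inductive Qual where
  | lin | un

/-- Interfaces: each pair of a service name and a session type is given a multiplicity, which
is infinite for the unrestricted (persistent) services. The union of interfaces is addition,
the preorder is the pointwise order, `Finsupp.single (a, α) h` is `⟨a : α, h⟩`. -/
abbrev Interface := ℕ × STy →₀ ℕ∞

/-- First-order environments: `vars` lists the basic types of the value variables, and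
`serv a = some (α, q, q')` stands for `a : ⟨α_q, dual(α)_q'⟩`. -/
structure Gamma where
  vars : List BTy
  serv : ℕ → Option (STy × Qual × Qual)

/-- Higher-order environments: interfaces of process variables and of locations. -/
structure Theta where
  pvars : List Interface
  locs : ℕ → Option Interface

/-- Assignments: `act k α` is `k : α`, and `brk p α` is `[κ^p : α]`, where `κ` is a channel that
is restricted in the typed process (its name is immaterial and has no index outside of the
restriction). -/
inductive Assign where
  | act (k : Sess) (α : STy)
  | brk (p : Pol) (α : STy)

def Assign.sub (σ : Sub) : Assign → Assign
  | .act k α => .act (k.sub σ) α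
  | .brk p α => .brk p α

/-- Typings `Δ`. -/
abbrev Typing := Multiset Assign

def Typing.sub (σ : Sub) (Δ : Typing) : Typing := Multiset.map (Assign.sub σ) Δ

/-- `k ∈ dom Δ`. -/
def Typing.Dom (Δ : Typing) (k : Sess) : Prop := ∃ α, Assign.act k α ∈ Δ

/-- A typing is balanced if with each assignment it has the dual one for the other endpoint. -/
def Balanced (Δ : Typing) : Prop :=
  (∀ p i α, Assign.act (.chan p i) α ∈ Δ → Assign.act (.chan p.dual i) α.dual ∈ Δ) ∧
  (∀ p α, Assign.brk p α ∈ Δ → Assign.brk p.dual α.dual ∈ Δ)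

/-! ### Typing rules -/

def Lit.ty : Lit → BTy
  | .int _ => .int
  | .bool _ => .bool
  | .str _ => .str

/-- Types of the operators. -/
inductive BinOp.HasTy : BinOp → BTy → BTy → BTy → Prop where
  | add : HasTy .add .int .int .int
  | sub : HasTy .sub .int .int .int
  | mul : HasTy .mul .int .int .int
  | le : HasTy .le .int .int .bool
  | eq (τ : BTy) : HasTy .eq τ τ .bool
  | and : HasTy .and .bool .bool .bool
  | or : HasTy .or .bool .bool .bool

/-- Typing of expressions. -/
inductive ExprTyped (Γ : Gamma) : Expr → BTy → Prop where
  | lit (c : Lit) : ExprTyped Γ (.const (.lit c)) c.ty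
  | name (i : ℕ) (τ : BTy) : Γ.vars[i]? = some τ → ExprTyped Γ (.const (.name i)) τ
  | bin {o : BinOp} {e₁ e₂ : Expr} {τ₁ τ₂ τ : BTy} :
      ExprTyped Γ e₁ τ₁ → ExprTyped Γ e₂ τ₂ → o.HasTy τ₁ τ₂ τ → ExprTyped Γ (.bin o e₁ e₂) τ

/-- The judgment `Γ; Θ ⊢ P ▷ Δ; I`. -/
inductive Typed : Gamma → Theta → Proc → Typing → Interface → Prop where
  | nil (Γ : Gamma) (Θ : Theta) : Typed Γ Θ .nil 0 0
  | pvar (Γ : Gamma) (Θ : Theta) (X : ℕ) (I : Interface) :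
      Θ.pvars[X]? = some I → Typed Γ Θ (.pvar X) 0 I
  | accept {Γ : Gamma} {Θ : Theta} {a : ℕ} {α : STy} {P : Proc} {Δ : Typing} {I : Interface} :
      Γ.serv a = some (α, .lin, .lin) →
      Typed Γ Θ P (Assign.act (.svar 0) α ::ₘ Δ.sub Sub.wkS) I →
      Typed Γ Θ (.accept a P) Δ (I + Finsupp.single (a, α) 1)
  | repAccept {Γ : Gamma} {Θ : Theta} {a : ℕ} {α : STy} {P : Proc} {I : Interface} :
      Γ.serv a = some (α, .un, .lin) →
      Typed Γ Θ P {Assign.act (.svar 0) α} I →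
      Typed Γ Θ (.repAccept a P) 0 ((⊤ : ℕ∞) • I + Finsupp.single (a, α) ⊤)
  | request {Γ : Gamma} {Θ : Theta} {a : ℕ} {α : STy} {q : Qual} {P : Proc} {Δ : Typing}
      {I : Interface} :
      Γ.serv a = some (α, q, .lin) →
      Typed Γ Θ P (Assign.act (.svar 0) α.dual ::ₘ Δ.sub Sub.wkS) I →
      Typed Γ Θ (.request a P) Δ (I + Finsupp.single (a, α.dual) 1)
  | loc {Γ : Gamma} {Θ : Theta} {l : ℕ} {h : ℤ} {P : Proc} {Δ : Typing} {I I' : Interface} :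
      Θ.locs l = some I → Typed Γ Θ P Δ I' → h = (Multiset.card Δ : ℤ) → I' ≤ I →
      Typed Γ Θ (.loc l h P) Δ I'
  | adapt {Γ : Gamma} {Θ : Theta} {l : ℕ} {P : Proc} {I I' : Interface} :
      Θ.locs l = some I → Typed Γ { Θ with pvars := I :: Θ.pvars } P 0 I' →
      Typed Γ Θ (.adapt l P) 0 0
  | send {Γ : Gamma} {Θ : Theta} {k : Sess} {es : List Expr} {τs : List BTy} {α : STy}
      {P : Proc} {Δ : Typing} {I : Interface} :
      List.Forall₂ (ExprTyped Γ) es τs → ¬ Δ.Dom k →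
      Typed Γ Θ P (Assign.act k α ::ₘ Δ) I →
      Typed Γ Θ (.send k es P) (Assign.act k (.send τs α) ::ₘ Δ) I
  | recv {Γ : Gamma} {Θ : Theta} {k : Sess} {τs : List BTy} {α : STy}
      {P : Proc} {Δ : Typing} {I : Interface} :
      ¬ Δ.Dom k →
      Typed { Γ with vars := τs ++ Γ.vars } Θ P (Assign.act k α ::ₘ Δ) I →
      Typed Γ Θ (.recv k τs.length P) (Assign.act k (.recv τs α) ::ₘ Δ) I
  | sendSess {Γ : Gamma} {Θ : Theta} {k k' : Sess} {α β : STy}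
      {P : Proc} {Δ : Typing} {I : Interface} :
      k ≠ k' → ¬ Δ.Dom k → ¬ Δ.Dom k' →
      Typed Γ Θ P (Assign.act k α ::ₘ Δ) I →
      Typed Γ Θ (.sendSess k k' P) (Assign.act k (.sendSess β α) ::ₘ Assign.act k' β ::ₘ Δ) I
  | recvSess {Γ : Gamma} {Θ : Theta} {k : Sess} {α β : STy}
      {P : Proc} {Δ : Typing} {I : Interface} :
      ¬ Δ.Dom k →
      Typed Γ Θ P
        (Assign.act (.svar 0) β ::ₘ Assign.act (k.sub Sub.wkS) α ::ₘ Δ.sub Sub.wkS) I →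
      Typed Γ Θ (.recvSess k P) (Assign.act k (.recvSess β α) ::ₘ Δ) I
  /-- The labels of a type are distinct; the order of the alternatives is irrelevant. -/
  | branch {Γ : Gamma} {Θ : Theta} {k : Sess} {m : ℕ} {lab labP : Fin (m + 1) → ℕ}
      {α : Fin (m + 1) → STy} {P : Fin (m + 1) → Proc} {Δ : Typing}
      {J : Fin (m + 1) → Interface} {I : Interface} (π : Equiv.Perm (Fin (m + 1))) :
      Function.Injective lab → (∀ i, labP i = lab (π i)) → ¬ Δ.Dom k →
      (∀ i, Typed Γ Θ (P i) (Assign.act k (α (π i)) ::ₘ Δ) (J i)) → (∀ i, J i ≤ I) →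
      Typed Γ Θ (.branch k m labP P) (Assign.act k (.branch m lab α) ::ₘ Δ) I
  | select {Γ : Gamma} {Θ : Theta} {k : Sess} {m : ℕ} {lab : Fin (m + 1) → ℕ}
      {α : Fin (m + 1) → STy} {P : Proc} {Δ : Typing} {I : Interface} (j : Fin (m + 1)) :
      Function.Injective lab → ¬ Δ.Dom k →
      Typed Γ Θ P (Assign.act k (α j) ::ₘ Δ) I →
      Typed Γ Θ (.select k (lab j) P) (Assign.act k (.select m lab α) ::ₘ Δ) I
  | cond {Γ : Gamma} {Θ : Theta} {e : Expr} {P Q : Proc} {Δ : Typing} {I₁ I₂ I : Interface} :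
      ExprTyped Γ e .bool → Typed Γ Θ P Δ I₁ → Typed Γ Θ Q Δ I₂ → I₁ ≤ I → I₂ ≤ I →
      Typed Γ Θ (.cond e P Q) Δ I
  | close {Γ : Gamma} {Θ : Theta} {k : Sess} {P : Proc} {Δ : Typing} {I : Interface} :
      ¬ Δ.Dom k → Typed Γ Θ P Δ I →
      Typed Γ Θ (.close k P) (Assign.act k .done ::ₘ Δ) I
  | par {Γ : Gamma} {Θ : Theta} {P Q : Proc} {Δ₁ Δ₂ : Typing} {I₁ I₂ : Interface} :
      (∀ k, Δ₁.Dom k → ¬ Δ₂.Dom k) → Typed Γ Θ P Δ₁ I₁ → Typed Γ Θ Q Δ₂ I₂ →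
      Typed Γ Θ (.par P Q) (Δ₁ + Δ₂) (I₁ + I₂)
  /-- Restriction of an active session. -/
  | res {Γ : Gamma} {Θ : Theta} {P : Proc} {α : STy} {Δ : Typing} {I : Interface} :
      Typed Γ Θ P (Assign.act (.chan .neg 0) α ::ₘ Assign.act (.chan .pos 0) α.dual ::ₘ
        Δ.sub Sub.wkC) I →
      Typed Γ Θ (.res P) (Assign.brk .neg α ::ₘ Assign.brk .pos α.dual ::ₘ Δ) I
  /-- Restriction of a channel that is not (or no longer) in use. -/
  | resUnused {Γ : Gamma} {Θ : Theta} {P : Proc} {Δ : Typing} {I : Interface} :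
      Typed Γ Θ P (Δ.sub Sub.wkC) I → Typed Γ Θ (.res P) Δ I

/-! ### Consistency -/

/-- The actions of prefixed processes: input and output with their arity, delegation and its
reception, selection with its label, branching with its set of labels, closing. -/
inductive Act where
  | send (n : ℕ)
  | recv (n : ℕ)
  | sendSess
  | recvSess
  | select (n : ℕ)
  | branch (L : Set ℕ)
  | close

/-- Complementary actions. -/
inductive Act.Compl : Act → Act → Prop where
  | symm {a b : Act} : Act.Compl a b → Act.Compl b a
  | io (n : ℕ) : Act.Compl (.send n) (.recv n)
  | pass : Act.Compl .sendSess .recvSess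
  | sel (n : ℕ) (L : Set ℕ) : n ∈ L → Act.Compl (.select n) (.branch L)
  | close : Act.Compl .close .close

/-- `P.HasAct i p a`: the process `P` contains, enclosed only in locations, parallel
compositions and restrictions, a process that is prefixed with the action `a` on the endpoint
`κ^p` of the channel `κ` with index `i` (a `κ`-process). -/
def Proc.HasAct (i : ℕ) (p : Pol) (a : Act) : Proc → Prop
  | .par P Q => P.HasAct i p a ∨ Q.HasAct i p a
  | .loc _ _ P => P.HasAct i p a
  | .res P => P.HasAct (i + 1) p a
  | .send k es _ => k = .chan p i ∧ a = .send es.length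
  | .recv k n _ => k = .chan p i ∧ a = .recv n
  | .sendSess k _ _ => k = .chan p i ∧ a = .sendSess
  | .recvSess k _ => k = .chan p i ∧ a = .recvSess
  | .branch k _ lab _ => k = .chan p i ∧ a = .branch (Set.range lab)
  | .select k n _ => k = .chan p i ∧ a = .select n
  | .close k _ => k = .chan p i ∧ a = .close
  | _ => False

/-- `P` contains a `κ`-redex, for the free channel `κ` with index `i`: two parallel
`κ`-processes, possibly enclosed in contexts, with complementary actions on the two endpoints
of `κ`. -/
def Proc.HasRedex (i : ℕ) : Proc → Prop
  | .par P Q => P.HasRedex i ∨ Q.HasRedex i ∨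
      ∃ p a b, Act.Compl a b ∧ P.HasAct i p a ∧ Q.HasAct i p.dual b
  | .loc _ _ P => P.HasRedex i
  | .res P => P.HasRedex (i + 1)
  | _ => False

/-- `P` contains a `κ`-redex for some channel `κ` that is restricted in `P`. -/
def Proc.HasRestrictedRedex : Proc → Prop
  | .par P Q => P.HasRestrictedRedex ∨ Q.HasRestrictedRedex
  | .loc _ _ P => P.HasRestrictedRedex
  | .res P => P.HasRedex 0 ∨ P.HasRestrictedRedex
  | _ => False

/-- Update consistency: for each process `P'` reachable from `P` that contains a `κ`-redex, all
update actions of `P'` lead to a process that contains a `κ`-redex. This is stated for free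
channels and for restricted channels. Since the name of a restricted channel is immaterial, the
last clause says moreover that it is the redex on the same restricted channel that is preserved:
it concerns all the ways of exposing restrictions of `P'` at top level. -/
def UpdateConsistent (P : Proc) : Prop :=
  ∀ P', Relation.ReflTransGen Red P P' →
    (∀ κ P'', P'.HasRedex κ → UpdRed P' P'' → P''.HasRedex κ) ∧
    (∀ P'', P'.HasRestrictedRedex → UpdRed P' P'' → P''.HasRestrictedRedex) ∧
    (∀ (n : ℕ) (R : Proc), Cong P' (Proc.res^[n] R) →
      ∀ κ R'', R.HasRedex κ → UpdRed R R'' → R''.HasRedex κ)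

end

end AdaptableSessions

namespace AdaptableSessions

/-! ### The session endpoints used by a process -/

/-! The types themselves play no role: what matters is the typing with its session types erased.
`Proc.use` computes this erasure from the process as a multiset of endpoints. An endpoint of a
restricted channel stays in it as `none`, just as bracketed assignments still count in `|Δ|`. The
invariant `Proc.WF` says that every annotation is the number of endpoints used inside its location,
and that the subject of an active prefix is always among the endpoints used. Distinctness of
endpoints and duality are not recorded.

Typed processes satisfy the invariant (`Typed.use_eq`, `Typed.wf`). Structural congruence preserves
it in both directions (`Cong.wf_iff`). Reduction preserves it because the shifts of annotations in
each rule are exactly the changes in the number of endpoints (`Ctx.card_use_fill`, `CommRule.wf`).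
So no subject reduction for the typing system is required.

An update consumes a location annotated `0`. By the invariant its content uses no endpoint at all,
hence has no active session prefix, free or restricted (`Proc.use_eq_zero_of_loc`,
`Proc.WF.mem_use_of_hasAct`). The consumed update process has none either. Every action and every
redex therefore lies in the untouched surroundings and survives (`UpdRule.simulates`,
`UpdRed.simulates`). -/

/-- Leaving the scope of a session variable; `none` stands for an endpoint of a restricted
channel. -/
def unbindS : Option Sess → Option (Option Sess)
  | none => some none
  | some (.svar 0) => none
  | some (.svar (i + 1)) => some (some (.svar i))
  | some (.chan p i) => some (some (.chan p i))

/-- Leaving the scope of a restriction. -/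
def unbindC : Option Sess → Option Sess
  | none => none
  | some (.svar i) => some (.svar i)
  | some (.chan _ 0) => none
  | some (.chan p (i + 1)) => some (.chan p i)

/-- The session endpoints that a process uses; the endpoints of restricted channels are anonymous
and appear as `none`. For typed processes this is the typing with the session types erased. -/
def Proc.use : Proc → Multiset (Option Sess)
  | .nil => 0
  | .par P Q => P.use + Q.use
  | .res P => P.use.map unbindC
  | .accept _ P => P.use.filterMap unbindS
  | .repAccept _ _ => 0
  | .request _ P => P.use.filterMap unbindS
  | .loc _ _ P => P.use
  | .pvar _ => 0
  | .adapt _ _ => 0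
  | .send _ _ P => P.use
  | .recv _ _ P => P.use
  | .sendSess _ k' P => some k' ::ₘ P.use
  | .recvSess _ P => P.use.filterMap unbindS
  | .branch _ _ _ P => (P 0).use
  | .select _ _ P => P.use
  | .cond _ P _ => P.use
  | .close k P => some k ::ₘ P.use

/-- Session endpoints are used linearly, and the annotation of each location is the number of the
endpoints used in it. -/
def Proc.WF : Proc → Prop
  | .nil => True
  | .par P Q => P.WF ∧ Q.WF
  | .res P => P.WF
  | .accept _ P => P.WF ∧ P.use.card = (P.use.filterMap unbindS).card + 1
  | .repAccept _ P => P.WF ∧ P.use = {some (.svar 0)}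
  | .request _ P => P.WF ∧ P.use.card = (P.use.filterMap unbindS).card + 1
  | .loc _ h P => P.WF ∧ h = (P.use.card : ℤ)
  | .pvar _ => True
  | .adapt _ P => P.WF ∧ P.use = 0
  | .send k _ P => P.WF ∧ some k ∈ P.use
  | .recv k _ P => P.WF ∧ some k ∈ P.use
  | .sendSess k _ P => P.WF ∧ some k ∈ P.use
  | .recvSess k P => P.WF ∧ P.use.card = (P.use.filterMap unbindS).card + 1 ∧
      some k ∈ P.use.filterMap unbindS
  | .branch k _ _ P => (∀ i, (P i).WF ∧ (P i).use = (P 0).use) ∧ some k ∈ (P 0).use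
  | .select k _ P => P.WF ∧ some k ∈ P.use
  | .cond _ P Q => P.WF ∧ Q.WF ∧ Q.use = P.use
  | .close _ P => P.WF

/-! ### Substitution -/

theorem Sess.sub_liftV (n : ℕ) (σ : Sub) : Sess.sub (σ.liftV n) = Sess.sub σ := by
  funext k; cases k <;> rfl

/-- Naturality of unbinding: the lift fixes the bound variable and shifts all other images past it,
and leaving the scope undoes the shift. -/
theorem unbindS_map_liftS (σ : Sub) (o : Option Sess) :
    unbindS (o.map (Sess.sub σ.liftS)) = (unbindS o).map (Option.map (Sess.sub σ)) := by
  rcases o with _ | ⟨_ | i⟩ | ⟨p, i⟩ <;> try rfl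
  simp only [Option.map_some, Sess.sub, Sub.liftS, unbindS]
  cases σ.sess i <;> rfl

theorem unbindC_map_liftC (σ : Sub) (o : Option Sess) :
    unbindC (o.map (Sess.sub σ.liftC)) = (unbindC o).map (Sess.sub σ) := by
  rcases o with _ | i | ⟨p, _ | i⟩ <;> try rfl
  simp only [Option.map_some, Sess.sub, Sub.liftC, unbindC]
  cases σ.sess i <;> rfl

theorem filterMap_unbindS_map_liftS (σ : Sub) (M : Multiset (Option Sess)) :
    (M.map (Option.map (Sess.sub σ.liftS))).filterMap unbindS =
      (M.filterMap unbindS).map (Option.map (Sess.sub σ)) := by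
  rw [Multiset.filterMap_map, Multiset.map_filterMap]
  congr 1
  funext o
  exact unbindS_map_liftS σ o

theorem map_unbindC_map_liftC (σ : Sub) (M : Multiset (Option Sess)) :
    (M.map (Option.map (Sess.sub σ.liftC))).map unbindC =
      (M.map unbindC).map (Option.map (Sess.sub σ)) := by
  simp only [Multiset.map_map, Function.comp_def, unbindC_map_liftC]

theorem Proc.use_sub (P : Proc) (σ : Sub) :
    (P.sub σ).use = P.use.map (Option.map (Sess.sub σ)) := by
  induction P generalizing σ <;>
    simp_all [Proc.sub, Proc.use, filterMap_unbindS_map_liftS, map_unbindC_map_liftC,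
      Sess.sub_liftV, -Multiset.map_map]

/-- A substitution may identify endpoints, but multisets count repetitions, so annotations stay
correct under any substitution. -/
theorem Proc.card_use_sub (P : Proc) (σ : Sub) : (P.sub σ).use.card = P.use.card := by
  rw [Proc.use_sub, Multiset.card_map]

theorem some_sub_mem {σ : Sub} {k : Sess} {M : Multiset (Option Sess)} (h : some k ∈ M) :
    some (k.sub σ) ∈ M.map (Option.map (Sess.sub σ)) :=
  Multiset.mem_map.2 ⟨some k, h, rfl⟩

/-- No injectivity is needed: the invariant consists of memberships, equalities of multisets and
counts, all of which survive mapping. -/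
theorem Proc.WF.sub {P : Proc} (h : P.WF) (σ : Sub) : (P.sub σ).WF := by
  induction P generalizing σ with
  | nil => trivial
  | pvar X => trivial
  | par P Q ihP ihQ => exact ⟨ihP h.1 σ, ihQ h.2 σ⟩
  | res P ih => exact ih h _
  | accept a P ih | request a P ih =>
    refine ⟨ih h.1 _, ?_⟩
    simpa [Proc.use_sub, filterMap_unbindS_map_liftS] using h.2
  | repAccept a P ih =>
    refine ⟨ih h.1 _, ?_⟩
    rw [Proc.use_sub, h.2]; rfl
  | loc l n P ih => exact ⟨ih h.1 σ, by rw [Proc.card_use_sub]; exact h.2⟩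
  | adapt l P ih => exact ⟨ih h.1 σ, by rw [Proc.use_sub, h.2]; rfl⟩
  | send k es P ih | sendSess k k' P ih | select k n P ih =>
    exact ⟨ih h.1 _, by rw [Proc.use_sub]; exact some_sub_mem h.2⟩
  | recv k n P ih =>
    exact ⟨ih h.1 _, by rw [Proc.use_sub, Sess.sub_liftV]; exact some_sub_mem h.2⟩
  | recvSess k P ih =>
    refine ⟨ih h.1 _, ?_, ?_⟩
    · simpa [Proc.use_sub, filterMap_unbindS_map_liftS] using h.2.1
    · rw [Proc.use_sub, filterMap_unbindS_map_liftS]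
      exact some_sub_mem h.2.2
  | branch k m lab P ih =>
    refine ⟨fun i => ⟨ih i (h.1 i).1 σ, ?_⟩, ?_⟩
    · simp only [Proc.use_sub, (h.1 i).2]
    · simp only [Proc.use_sub]
      exact some_sub_mem h.2
  | cond e P Q ihP ihQ =>
    exact ⟨ihP h.1 σ, ihQ h.2.1 σ, by rw [Proc.use_sub, Proc.use_sub, h.2.2]⟩
  | close k P ih => exact ih h σ

/-! ### Injective substitutions reflect the invariant -/

/-- `unbindS` is itself injective on subjects and intertwines the lift with `σ`. -/
theorem Sess.sub_liftS_injective {σ : Sub} (hσ : Function.Injective (Sess.sub σ)) :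
    Function.Injective (Sess.sub σ.liftS) := by
  intro k k' h
  have h1 := unbindS_map_liftS σ (some k)
  have h2 := unbindS_map_liftS σ (some k')
  simp only [Option.map_some, h] at h1 h2
  have h3 : unbindS (some k) = unbindS (some k') :=
    Option.map_injective (Option.map_injective hσ) (h1.symm.trans h2)
  rcases k with ⟨_ | i⟩ | ⟨p, i⟩ <;> rcases k' with ⟨_ | i'⟩ | ⟨p', i'⟩ <;>
    simp_all [unbindS]

theorem Sess.sub_liftC_eq_zero (σ : Sub) (k : Sess) (p : Pol) :
    k.sub σ.liftC = .chan p 0 ↔ k = .chan p 0 := by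
  rcases k with i | ⟨q, _ | i⟩
  · simp only [Sess.sub, Sub.liftC]
    cases σ.sess i <;> simp [Sub.wkC, Sub.id]
  · simp [Sess.sub, Sub.liftC]
  · simp [Sess.sub, Sub.liftC]

theorem Sess.sub_liftC_eq_succ (σ : Sub) (k : Sess) (p : Pol) (i : ℕ) :
    k.sub σ.liftC = .chan p (i + 1) ↔
      ∃ k', unbindC (some k) = some k' ∧ k'.sub σ = .chan p i := by
  rcases k with j | ⟨q, _ | j⟩
  · simp only [Sess.sub, Sub.liftC, unbindC]
    cases h : σ.sess j <;> simp [Sub.wkC, Sub.id, h]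
  · simp [Sess.sub, Sub.liftC, unbindC]
  · simp [Sess.sub, Sub.liftC, unbindC]

/-- `unbindC` identifies only the two endpoints of channel `0`, and these are fixed by the lift,
hence kept apart. -/
theorem Sess.sub_liftC_injective {σ : Sub} (hσ : Function.Injective (Sess.sub σ)) :
    Function.Injective (Sess.sub σ.liftC) := by
  intro k k' h
  have h1 := unbindC_map_liftC σ (some k)
  have h2 := unbindC_map_liftC σ (some k')
  simp only [Option.map_some, h] at h1 h2
  have h3 : unbindC (some k) = unbindC (some k') :=
    Option.map_injective hσ (h1.symm.trans h2)
  rcases k with i | ⟨p, _ | i⟩ <;> rcases k' with i' | ⟨p', _ | i'⟩ <;>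
    simp_all [unbindC, Sess.sub, Sub.liftC]

/-- Needed to read scope extrusion and the exchange of restrictions backwards. Memberships and
equalities of multisets are reflected only along injective maps. -/
theorem Proc.WF.of_sub {P : Proc} {σ : Sub} (hσ : Function.Injective (Sess.sub σ))
    (h : (P.sub σ).WF) : P.WF := by
  have mem : ∀ {σ : Sub} (_ : Function.Injective (Sess.sub σ)) {k : Sess}
      {M : Multiset (Option Sess)}, some (k.sub σ) ∈ M.map (Option.map (Sess.sub σ)) →
      some k ∈ M := fun {σ} hσ {k M} h =>
    (Multiset.mem_map_of_injective (Option.map_injective hσ) (a := some k)).1 h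
  induction P generalizing σ with
  | nil => trivial
  | pvar X => trivial
  | par P Q ihP ihQ => exact ⟨ihP hσ h.1, ihQ hσ h.2⟩
  | res P ih => exact ih (Sess.sub_liftC_injective hσ) h
  | accept a P ih | request a P ih =>
    refine ⟨ih (Sess.sub_liftS_injective hσ) h.1, ?_⟩
    simpa [Proc.use_sub, filterMap_unbindS_map_liftS] using h.2
  | repAccept a P ih =>
    have hσ' := Sess.sub_liftS_injective hσ
    refine ⟨ih hσ' h.1, Multiset.map_injective (Option.map_injective hσ') ?_⟩
    rw [← Proc.use_sub, h.2]; rfl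
  | loc l n P ih => exact ⟨ih hσ h.1, by rw [← Proc.card_use_sub P σ]; exact h.2⟩
  | adapt l P ih =>
    have h2 := h.2
    rw [Proc.use_sub] at h2
    exact ⟨ih hσ h.1, Multiset.map_eq_zero.1 h2⟩
  | send k es P ih | sendSess k k' P ih | select k n P ih =>
    have h2 := h.2
    rw [Proc.use_sub] at h2
    exact ⟨ih hσ h.1, mem hσ h2⟩
  | recv k n P ih =>
    have h2 := h.2
    rw [Proc.use_sub, Sess.sub_liftV] at h2
    exact ⟨ih (by rwa [Sess.sub_liftV]) h.1, mem hσ h2⟩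
  | recvSess k P ih =>
    have h3 := h.2.2
    rw [Proc.use_sub, filterMap_unbindS_map_liftS] at h3
    refine ⟨ih (Sess.sub_liftS_injective hσ) h.1, ?_, mem hσ h3⟩
    simpa [Proc.use_sub, filterMap_unbindS_map_liftS] using h.2.1
  | branch k m lab P ih =>
    have h2 := h.2
    simp only [Proc.use_sub] at h2
    refine ⟨fun i => ⟨ih i hσ (h.1 i).1,
      Multiset.map_injective (Option.map_injective hσ) ?_⟩, mem hσ h2⟩
    simpa only [Proc.use_sub] using (h.1 i).2
  | cond e P Q ihP ihQ =>
    refine ⟨ihP hσ h.1, ihQ hσ h.2.1, Multiset.map_injective (Option.map_injective hσ) ?_⟩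
    simpa only [Proc.use_sub] using h.2.2
  | close k P ih => exact ih hσ h

/-! ### Substitution for process variables -/

theorem Proc.use_renP (P : Proc) (f : ℕ → ℕ) : (P.renP f).use = P.use := by
  induction P generalizing f <;> simp_all [Proc.renP, Proc.use]

theorem Proc.WF.renP {P : Proc} (h : P.WF) (f : ℕ → ℕ) : (P.renP f).WF := by
  induction P generalizing f <;> simp_all [Proc.renP, Proc.WF, Proc.use_renP]

/-- A process variable counts as using nothing, so putting in processes that use nothing changes no
count. -/
theorem Proc.use_subP (P : Proc) {θ : ℕ → Proc} (hθ : ∀ X, (θ X).use = 0) :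
    (P.subP θ).use = P.use := by
  induction P generalizing θ <;> simp_all [Proc.subP, Proc.use, Proc.use_sub]

theorem Proc.WF.subP {P : Proc} (h : P.WF) {θ : ℕ → Proc} (hθ : ∀ X, (θ X).use = 0)
    (hw : ∀ X, (θ X).WF) : (P.subP θ).WF := by
  have lift : ∀ {θ : ℕ → Proc} (σ : Sub), (∀ X, (θ X).use = 0) →
      ∀ X, ((θ X).sub σ).use = 0 := fun σ hθ X => by rw [Proc.use_sub, hθ]; rfl
  induction P generalizing θ with
  | nil => trivial
  | pvar X => exact hw X
  | par P Q ihP ihQ => exact ⟨ihP h.1 hθ hw, ihQ h.2 hθ hw⟩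
  | res P ih => exact ih h (lift _ hθ) fun X => (hw X).sub _
  | accept a P ih | request a P ih | repAccept a P ih | recvSess k P ih =>
    refine ⟨ih h.1 (lift _ hθ) fun X => (hw X).sub _, ?_⟩
    rw [Proc.use_subP P (lift _ hθ)]
    exact h.2
  | recv k n P ih =>
    refine ⟨ih h.1 (lift _ hθ) fun X => (hw X).sub _, ?_⟩
    rw [Proc.use_subP P (lift _ hθ)]
    exact h.2
  | loc l n P ih | send k es P ih | sendSess k k' P ih | select k n P ih =>
    refine ⟨ih h.1 hθ hw, ?_⟩
    rw [Proc.use_subP P hθ]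
    exact h.2
  | adapt l P ih =>
    have h0 : ∀ X, (Proc.use (match X with
      | 0 => Proc.pvar 0
      | i + 1 => (θ i).renP Nat.succ)) = 0 := by
      rintro (_ | i)
      · rfl
      · exact (Proc.use_renP _ _).trans (hθ i)
    refine ⟨ih h.1 h0 ?_, ?_⟩
    · rintro (_ | i)
      · trivial
      · exact (hw i).renP _
    · rw [Proc.use_subP P h0]
      exact h.2
  | branch k m lab P ih =>
    refine ⟨fun i => ⟨ih i (h.1 i).1 hθ hw, ?_⟩, ?_⟩
    · simp only [Proc.use_subP _ hθ, (h.1 i).2]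
    · simp only [Proc.use_subP _ hθ]
      exact h.2
  | cond e P Q ihP ihQ =>
    exact ⟨ihP h.1 hθ hw, ihQ h.2.1 hθ hw, by
      simp only [Proc.use_subP _ hθ, h.2.2]⟩
  | close k P ih => exact ih h hθ hw

/-! ### Structural congruence -/

theorem Sess.sub_wkC_injective : Function.Injective (Sess.sub Sub.wkC) := by
  rintro (i | ⟨p, i⟩) (j | ⟨q, j⟩) h <;> simp_all [Sess.sub, Sub.wkC, Sub.id]

theorem Sess.sub_swapC_eq (k : Sess) (p : Pol) (i : ℕ) :
    k.sub Sub.swapC = .chan p i ↔ k = .chan p (Sub.swapC.chan i) := by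
  rcases k with j | ⟨q, j⟩
  · simp [Sess.sub, Sub.swapC, Sub.id]
  · simp only [Sess.sub, Sub.swapC, Sess.chan.injEq, and_congr_right_iff]
    intro _
    grind

theorem Sess.sub_swapC_injective : Function.Injective (Sess.sub Sub.swapC) := by
  rintro (i | ⟨p, i⟩) (j | ⟨q, j⟩) h <;> 
    simp_all [Sess.sub, Sub.swapC, Sub.id]
  grind

theorem unbindC_wkC (o : Option Sess) : unbindC (o.map (Sess.sub Sub.wkC)) = o := by
  rcases o with _ | i | ⟨p, i⟩ <;> rfl

/-- Outside both restrictions the endpoints of the two channels are equally anonymous. -/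
theorem unbindC_unbindC_swapC (o : Option Sess) :
    unbindC (unbindC (o.map (Sess.sub Sub.swapC))) = unbindC (unbindC o) := by
  rcases o with _ | i | ⟨p, _ | _ | i⟩ <;> rfl

theorem Cong.use_eq {P Q : Proc} (h : Cong P Q) : P.use = Q.use := by
  induction h with
  | resSwap P =>
    simp only [Proc.use, Proc.use_sub, Multiset.map_map, Function.comp_def,
      unbindC_unbindC_swapC]
  | resPar P Q =>
    simp only [Proc.use, Proc.use_sub, Multiset.map_add, Multiset.map_map, Function.comp_def,
      unbindC_wkC, Multiset.map_id']
  | parComm P Q => exact add_comm _ _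
  | parAssoc P Q R => exact add_assoc _ _ _
  | _ => simp_all [Proc.use]

theorem Cong.wf_iff {P Q : Proc} (h : Cong P Q) : P.WF ↔ Q.WF := by
  induction h with
  | resSwap P => exact ⟨fun h => Proc.WF.sub (P := P) h _,
      fun h => Proc.WF.of_sub (P := P) Sess.sub_swapC_injective h⟩
  | resPar P Q =>
    exact and_congr_right fun _ => ⟨fun h => h.sub _, Proc.WF.of_sub Sess.sub_wkC_injective⟩
  | parComm P Q => exact and_comm
  | parAssoc P Q R => exact and_assoc
  | parNil P => exact iff_of_eq (and_true _)
  -- Restriction renames endpoints to `none` without dropping them, so the annotation is the same on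
  -- either side of it.
  | resLoc l n P => simp [Proc.WF, Proc.use]
  | symm _ ih => exact ih.symm
  | trans _ _ ih ih' => exact ih.trans ih'
  | par _ _ ih ih' => exact and_congr ih ih'
  | cond e h h' ih ih' => simp only [Proc.WF, ih, ih', h.use_eq, h'.use_eq]
  | branch k m lab h ih => simp only [Proc.WF, ih, (h _).use_eq]
  | accept a h ih | repAccept a h ih | request a h ih | loc l n h ih | adapt l h ih
  | send k es h ih | recv k n h ih | sendSess k k' h ih | recvSess k h ih | select k n h ih =>
    simp only [Proc.WF, ih, h.use_eq]
  | _ => simp_all [Proc.WF]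

/-! ### Typed processes -/

def Assign.use : Assign → Option Sess
  | .act k _ => some k
  | .brk _ _ => none

theorem Assign.use_sub (σ : Sub) (A : Assign) :
    (A.sub σ).use = A.use.map (Sess.sub σ) := by
  cases A <;> rfl

theorem unbindS_wkS (o : Option Sess) : unbindS (o.map (Sess.sub Sub.wkS)) = some o := by
  rcases o with _ | i | ⟨p, i⟩ <;> rfl

theorem Typing.filterMap_unbindS_wkS (Δ : Typing) :
    ((Δ.sub Sub.wkS).map Assign.use).filterMap unbindS = Δ.map Assign.use := by
  simp only [Typing.sub, Multiset.map_map, Function.comp_def, Assign.use_sub,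
    Multiset.filterMap_map, unbindS_wkS]
  rw [← Multiset.filterMap_eq_map]
  rfl

theorem Typing.filterMap_unbindS_cons_cons_wkS (k : Sess) (α β : STy) (Δ : Typing) :
    ((Assign.act (.svar 0) β ::ₘ Assign.act (k.sub Sub.wkS) α ::ₘ Δ.sub Sub.wkS).map
      Assign.use).filterMap unbindS = some k ::ₘ Δ.map Assign.use := by
  have h := Typing.filterMap_unbindS_wkS (Assign.act k α ::ₘ Δ)
  rw [Multiset.map_cons, Multiset.filterMap_cons_none _ _ rfl]
  rwa [Typing.sub, Multiset.map_cons, Multiset.map_cons Assign.use _ Δ] at h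

theorem Typing.map_unbindC_wkC (Δ : Typing) :
    ((Δ.sub Sub.wkC).map Assign.use).map unbindC = Δ.map Assign.use := by
  simp only [Typing.sub, Multiset.map_map, Function.comp_def, Assign.use_sub, unbindC_wkC]

/-- Each typing rule acts on the erased typing as the matching clause of `Proc.use`. Most prefixes
only change the type of their subject; delegation and closing add an endpoint. Both restriction
rules erase to the same map. -/
theorem Typed.use_eq {Γ : Gamma} {Θ : Theta} {P : Proc} {Δ : Typing} {I : Interface}
    (h : Typed Γ Θ P Δ I) : P.use = Δ.map Assign.use := by
  induction h with
  | accept _ _ ih | request _ _ ih =>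
    rw [Proc.use, ih, Multiset.map_cons, Multiset.filterMap_cons_none _ _ rfl,
      Typing.filterMap_unbindS_wkS]
  | recvSess _ _ ih =>
    rw [Proc.use, ih, Typing.filterMap_unbindS_cons_cons_wkS, Multiset.map_cons]
    rfl
  | sendSess _ _ _ _ ih =>
    rw [Proc.use, ih, Multiset.map_cons, Multiset.map_cons, Multiset.map_cons,
      Multiset.cons_swap]
    rfl
  | res _ ih =>
    rw [Proc.use, ih, Multiset.map_cons, Multiset.map_cons, Multiset.map_cons,
      Multiset.map_cons, Typing.map_unbindC_wkC, Multiset.map_cons, Multiset.map_cons]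
    rfl
  | resUnused _ ih => rw [Proc.use, ih, Typing.map_unbindC_wkC]
  | _ => simp_all [Proc.use, Assign.use]

theorem Typed.wf {Γ : Gamma} {Θ : Theta} {P : Proc} {Δ : Typing} {I : Interface}
    (h : Typed Γ Θ P Δ I) : P.WF := by
  induction h with
  | nil => trivial
  | pvar => trivial
  | accept _ h ih | request _ h ih =>
    refine ⟨ih, ?_⟩
    rw [h.use_eq, Multiset.map_cons, Multiset.filterMap_cons_none _ _ rfl,
      Typing.filterMap_unbindS_wkS]
    simp [Typing.sub]
  | repAccept _ h ih => exact ⟨ih, h.use_eq⟩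
  | loc _ h hh _ ih => exact ⟨ih, by rw [h.use_eq, Multiset.card_map]; exact hh⟩
  | adapt _ h ih => exact ⟨ih, h.use_eq⟩
  | send _ _ h ih | recv _ h ih | sendSess _ _ _ h ih =>
    exact ⟨ih, by rw [h.use_eq, Multiset.map_cons]; exact Multiset.mem_cons_self _ _⟩
  | select _ _ _ h ih =>
    exact ⟨ih, by rw [h.use_eq, Multiset.map_cons]; exact Multiset.mem_cons_self _ _⟩
  | recvSess _ h ih =>
    refine ⟨ih, ?_, ?_⟩ <;> rw [h.use_eq, Typing.filterMap_unbindS_cons_cons_wkS]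
    · simp [Typing.sub]
    · exact Multiset.mem_cons_self _ _
  | branch _ _ _ _ h _ ih =>
    refine ⟨fun i => ⟨ih i, ?_⟩, ?_⟩
    · rw [(h i).use_eq, (h 0).use_eq, Multiset.map_cons, Multiset.map_cons]
      rfl
    · rw [(h 0).use_eq, Multiset.map_cons]
      exact Multiset.mem_cons_self _ _
  | cond _ h h' _ _ ih ih' => exact ⟨ih, ih', h'.use_eq.trans h.use_eq.symm⟩
  | close _ _ ih => exact ih
  | par _ _ _ ih ih' => exact ⟨ih, ih'⟩
  | res _ ih => exact ih
  | resUnused _ ih => exact ih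

/-! ### Reduction -/

/-- The shift `d` is an integer because delegation and closing lower the count. The annotations do
not enter `Proc.use`, so `bump` is harmless here. -/
theorem Ctx.card_use_fill (C : Ctx) {X Y : Proc} {d : ℤ}
    (hd : (Y.use.card : ℤ) = X.use.card + d) :
    (((C.bump d).fill Y).use.card : ℤ) = (C.fill X).use.card + d := by
  induction C with
  | hole => exact hd
  | loc l h C P ih =>
    simp only [Ctx.bump, Ctx.fill, Proc.use, Multiset.card_add, Nat.cast_add, ih]
    ring

theorem Ctx.wf_of_fill {C : Ctx} {X : Proc} (h : (C.fill X).WF) : X.WF := by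
  induction C with
  | hole => exact h
  | loc l n C P ih => exact ih h.1.1

/-- Filling a context with a process that uses `d` more endpoints. -/
theorem Ctx.wf_bump_fill {C : Ctx} {X Y : Proc} {d : ℤ} (h : (C.fill X).WF) (hY : Y.WF)
    (hd : (Y.use.card : ℤ) = X.use.card + d) : ((C.bump d).fill Y).WF := by
  induction C with
  | hole => exact hY
  | loc l n C P ih =>
    refine ⟨⟨ih h.1.1, h.1.2⟩, ?_⟩
    have h2 := h.2
    have h3 := C.card_use_fill hd
    simp only [Proc.use, Multiset.card_add, Nat.cast_add] at h2 ⊢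
    omega

theorem Ctx.bump_zero (C : Ctx) : C.bump 0 = C := by
  induction C <;> simp_all [Ctx.bump]

theorem Ctx.fill_wkC (C : Ctx) (X : Proc) :
    (C.fill X).sub Sub.wkC = C.wkC.fill (X.sub Sub.wkC) := by
  induction C <;> simp_all [Ctx.wkC, Ctx.fill, Proc.sub]

/-- Replacement of two parallel processes in contexts. -/
theorem Ctx.wf_fill_par {E C D : Ctx} {X X' Y Y' : Proc} {c d : ℤ}
    (h : (E.fill (.par (C.fill X) (D.fill Y))).WF) (hX : X'.WF) (hY : Y'.WF)
    (hc : (X'.use.card : ℤ) = X.use.card + c) (hd : (Y'.use.card : ℤ) = Y.use.card + d) :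
    ((E.bump (c + d)).fill (.par ((C.bump c).fill X') ((D.bump d).fill Y'))).WF := by
  have hp := Ctx.wf_of_fill h
  refine Ctx.wf_bump_fill h ⟨Ctx.wf_bump_fill hp.1 hX hc, Ctx.wf_bump_fill hp.2 hY hd⟩ ?_
  have h1 := C.card_use_fill hc
  have h2 := D.card_use_fill hd
  simp only [Proc.use, Multiset.card_add, Nat.cast_add]
  omega

theorem Ctx.wf_fill_par_zero {E C D : Ctx} {X X' Y Y' : Proc}
    (h : (E.fill (.par (C.fill X) (D.fill Y))).WF) (hX : X'.WF) (hY : Y'.WF)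
    (hc : X'.use.card = X.use.card) (hd : Y'.use.card = Y.use.card) :
    (E.fill (.par (C.fill X') (D.fill Y'))).WF := by
  have := Ctx.wf_fill_par (c := 0) (d := 0) h hX hY (by simp [hc]) (by simp [hd])
  simpa only [add_zero, Ctx.bump_zero] using this

/-- Replacement of two parallel processes in contexts by processes that share a new channel. -/
theorem Ctx.wf_fill_res_par {E C D : Ctx} {X X' Y Y' : Proc}
    (h : (E.fill (.par (C.fill X) (D.fill Y))).WF) (hX : X'.WF) (hY : Y'.WF)
    (hc : X'.use.card = X.use.card + 1) (hd : Y'.use.card = Y.use.card + 1) :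
    ((E.bump 2).fill (.res (.par ((C.wkC.bump 1).fill X') ((D.wkC.bump 1).fill Y')))).WF := by
  have hp := Ctx.wf_of_fill h
  have h1 := hp.1.sub Sub.wkC
  have h2 := hp.2.sub Sub.wkC
  have h3 := (C.fill X).card_use_sub Sub.wkC
  have h4 := (D.fill Y).card_use_sub Sub.wkC
  rw [Ctx.fill_wkC] at h1 h2 h3 h4
  have hc' : (X'.use.card : ℤ) = (X.sub Sub.wkC).use.card + 1 := by
    rw [Proc.card_use_sub, hc]; rfl
  have hd' : (Y'.use.card : ℤ) = (Y.sub Sub.wkC).use.card + 1 := by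
    rw [Proc.card_use_sub, hd]; rfl
  refine Ctx.wf_bump_fill h ⟨Ctx.wf_bump_fill h1 hX hc', Ctx.wf_bump_fill h2 hY hd'⟩ ?_
  have h5 := C.wkC.card_use_fill hc'
  have h6 := D.wkC.card_use_fill hd'
  -- The new channel is restricted, but its two endpoints remain counted as `none`; this is the `2`
  -- added to `E`.
  simp only [Proc.use, Multiset.card_map, Multiset.card_add, Nat.cast_add]
  omega

/-- The one place where the side condition of the update rule enters: a correct annotation `0` means
an empty multiset of endpoints, restricted ones included. -/
theorem Proc.use_eq_zero_of_loc {l : ℕ} {Q : Proc} (h : (Proc.loc l 0 Q).WF) : Q.use = 0 :=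
  Multiset.card_eq_zero.1 (by exact_mod_cast h.2.symm)

/-- The location and the process replacing it both use nothing, so no annotation around them has to
change. -/
theorem UpdRule.wf {P Q : Proc} (h : UpdRule P Q) (hP : P.WF) : Q.WF := by
  obtain ⟨E, C, D, l, P, Q⟩ := h
  obtain ⟨hC, hD⟩ := Ctx.wf_of_fill hP
  have hQ := Ctx.wf_of_fill hC
  have hA := Ctx.wf_of_fill hD
  have h0 := Proc.use_eq_zero_of_loc hQ
  have hθ : ∀ X, (Proc.use (match X with
      | 0 => Q
      | i + 1 => .pvar i)) = 0 := by
    rintro (_ | i)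
    · exact h0
    · rfl
  refine Ctx.wf_fill_par_zero hP (hA.1.subP hθ ?_) trivial ?_ rfl
  · rintro (_ | i)
    · exact hQ.1
    · trivial
  · rw [Proc.instP, Proc.use_subP P hθ, hA.2, Proc.use, h0]

theorem CommRule.wf {P Q : Proc} (h : CommRule P Q) (hP : P.WF) : Q.WF := by
  cases h with
  | ifTrue C e P Q _ =>
    have h := Ctx.wf_of_fill hP
    have := Ctx.wf_bump_fill (d := 0) (Y := P) hP h.1 (by simp [Proc.use])
    rwa [Ctx.bump_zero] at this
  | ifFalse C e P Q _ =>
    have h := Ctx.wf_of_fill hP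
    have := Ctx.wf_bump_fill (d := 0) (Y := Q) hP h.2.1 (by simp [Proc.use, h.2.2])
    rwa [Ctx.bump_zero] at this
  | opn E C D a P Q =>
    obtain ⟨hC, hD⟩ := Ctx.wf_of_fill hP
    have hX := Ctx.wf_of_fill hC
    have hY := Ctx.wf_of_fill hD
    refine Ctx.wf_fill_res_par hP (hX.1.sub _) (hY.1.sub _) ?_ ?_
    · exact (Proc.card_use_sub _ _).trans hX.2
    · exact (Proc.card_use_sub _ _).trans hY.2
  | ropn E C D a P Q =>
    obtain ⟨hC, hD⟩ := Ctx.wf_of_fill hP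
    have hX := Ctx.wf_of_fill hC
    have hY := Ctx.wf_of_fill hD
    refine Ctx.wf_fill_res_par hP ⟨hX.1.sub _, hX.sub _⟩ (hY.1.sub _) ?_ ?_
    -- The replicated copy that is kept uses nothing, and the unfolded body uses exactly the new
    -- endpoint.
    · rw [Proc.use, Multiset.card_add, Proc.card_use_sub, Proc.instNew, Proc.card_use_sub, hX.2]
      rfl
    · exact (Proc.card_use_sub _ _).trans hY.2
  | io E C D p i n es cs P Q _ _ =>
    obtain ⟨hC, hD⟩ := Ctx.wf_of_fill hP
    exact Ctx.wf_fill_par_zero hP (Ctx.wf_of_fill hC).1 ((Ctx.wf_of_fill hD).1.sub _) rfl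
      (Proc.card_use_sub _ _)
  | pass E C D p q i j P Q =>
    obtain ⟨hC, hD⟩ := Ctx.wf_of_fill hP
    have hY := Ctx.wf_of_fill hD
    -- The sender gives up the delegated endpoint. The receiver gains it in place of its bound
    -- variable, which was not counted before. The net change for `E` is `0`.
    have := Ctx.wf_fill_par (c := -1) (d := 1) hP (Ctx.wf_of_fill hC).1
      (hY.1.sub { Sub.id with sess := fun i => match i with
        | 0 => .chan q j
        | i + 1 => .svar i }) (by simp [Proc.use])
      (by rw [Proc.card_use_sub, hY.2.1]; simp [Proc.use])
    rwa [neg_add_cancel, Ctx.bump_zero] at this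
  | sel E C D p i m lab P j Q =>
    obtain ⟨hC, hD⟩ := Ctx.wf_of_fill hP
    have hX := Ctx.wf_of_fill hC
    exact Ctx.wf_fill_par_zero hP (hX.1 j).1 (Ctx.wf_of_fill hD).1 (by rw [(hX.1 j).2, Proc.use])
      rfl
  | close E C D p i P Q =>
    obtain ⟨hC, hD⟩ := Ctx.wf_of_fill hP
    have hX := Ctx.wf_of_fill hC
    have hY := Ctx.wf_of_fill hD
    -- Each side loses the endpoint that it closes.
    exact Ctx.wf_fill_par (X' := P) (Y' := Q) (c := -1) (d := -1) hP hX hY (by simp [Proc.use])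
      (by simp [Proc.use])

theorem RedClosure.wf {B : Proc → Proc → Prop} (hB : ∀ P Q, B P Q → P.WF → Q.WF) {P Q : Proc}
    (h : RedClosure B P Q) (hP : P.WF) : Q.WF := by
  induction h with
  | base h => exact hB _ _ h hP
  | str h _ h' ih => exact h'.wf_iff.1 (ih (h.wf_iff.1 hP))
  | par Q _ ih => exact ⟨ih hP.1, hP.2⟩
  | res _ ih => exact ih hP

theorem Red.wf {P Q : Proc} (h : Red P Q) (hP : P.WF) : Q.WF :=
  RedClosure.wf (fun _ _ h => h.elim UpdRule.wf CommRule.wf) h hP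

/-! ### Actions and redexes under substitution -/

/-- It suffices that the only subject sent to the endpoint with index `j` is the one with index `i`,
a condition stable under restriction. This covers both weakening and exchange. -/
theorem Proc.hasAct_sub_iff (Q : Proc) {σ : Sub} {p : Pol} {i j : ℕ} (a : Act)
    (hσ : ∀ k : Sess, k.sub σ = .chan p j ↔ k = .chan p i) :
    (Q.sub σ).HasAct j p a ↔ Q.HasAct i p a := by
  induction Q generalizing σ i j with
  | res P ih =>
    refine ih fun k => ?_
    rw [Sess.sub_liftC_eq_succ]
    simp only [hσ, exists_eq_right]
    rcases k with n | ⟨q, _ | n⟩ <;> simp [unbindC]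
  | _ => simp_all [Proc.sub, Proc.HasAct]

theorem Proc.not_hasAct_sub (Q : Proc) {σ : Sub} {p : Pol} {j : ℕ} (a : Act)
    (hσ : ∀ k : Sess, k.sub σ ≠ .chan p j) : ¬ (Q.sub σ).HasAct j p a := by
  induction Q generalizing σ j with
  | res P ih =>
    refine ih fun k => ?_
    rw [Ne, Sess.sub_liftC_eq_succ]
    rintro ⟨k', -, h⟩
    exact hσ k' h
  | _ => simp_all [Proc.sub, Proc.HasAct]

theorem Proc.hasRedex_sub_iff (Q : Proc) {σ : Sub} {i j : ℕ}
    (hσ : ∀ (p : Pol) (k : Sess), k.sub σ = .chan p j ↔ k = .chan p i) :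
    (Q.sub σ).HasRedex j ↔ Q.HasRedex i := by
  induction Q generalizing σ i j with
  | res P ih =>
    refine ih fun p k => ?_
    rw [Sess.sub_liftC_eq_succ]
    simp only [hσ, exists_eq_right]
    rcases k with n | ⟨q, _ | n⟩ <;> simp [unbindC]
  | par P Q ihP ihQ =>
    simp only [Proc.sub, Proc.HasRedex, ihP hσ, ihQ hσ, P.hasAct_sub_iff _ (hσ _),
      Q.hasAct_sub_iff _ (hσ _)]
  | loc l h P ih => exact ih hσ
  | _ => exact Iff.rfl

/-- Any `σ` is allowed, since its lift sends nothing but the restricted channel itself to that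
channel. -/
theorem Proc.hasRestrictedRedex_sub_iff (Q : Proc) (σ : Sub) :
    (Q.sub σ).HasRestrictedRedex ↔ Q.HasRestrictedRedex := by
  induction Q generalizing σ with
  | res P ih =>
    exact or_congr (P.hasRedex_sub_iff fun p k => Sess.sub_liftC_eq_zero σ k p) (ih _)
  | par P Q ihP ihQ => exact or_congr (ihP σ) (ihQ σ)
  | loc l h P ih => exact ih σ
  | _ => exact Iff.rfl

theorem Proc.HasRedex.exists_hasAct {P : Proc} {i : ℕ} (h : P.HasRedex i) :
    ∃ p a, P.HasAct i p a := by
  induction P generalizing i with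
  | par P Q ihP ihQ =>
    rcases h with h | h | ⟨p, a, -, -, h, -⟩
    · obtain ⟨p, a, h⟩ := ihP h
      exact ⟨p, a, .inl h⟩
    · obtain ⟨p, a, h⟩ := ihQ h
      exact ⟨p, a, .inr h⟩
    · exact ⟨p, a, .inl h⟩
  | loc l n P ih => exact ih h
  | res P ih => exact ih h
  | _ => exact h.elim

theorem Sess.sub_wkC_ne_zero (k : Sess) (p : Pol) : k.sub Sub.wkC ≠ .chan p 0 := by
  cases k <;> simp [Sess.sub, Sub.wkC, Sub.id]

theorem Sess.sub_wkC_eq_succ (k : Sess) (p : Pol) (i : ℕ) :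
    k.sub Sub.wkC = .chan p (i + 1) ↔ k = .chan p i := by
  cases k <;> simp [Sess.sub, Sub.wkC, Sub.id]

/-- Only unguarded prefixes count, so congruence below a prefix is invisible. -/
theorem Cong.hasAct_iff {P Q : Proc} (h : Cong P Q) (i : ℕ) (p : Pol) (a : Act) :
    P.HasAct i p a ↔ Q.HasAct i p a := by
  induction h generalizing i with
  | symm _ ih => exact (ih i).symm
  | trans _ _ ih ih' => exact (ih i).trans (ih' i)
  | parComm P Q => exact or_comm
  | parAssoc P Q R => exact or_assoc
  | parNil P => exact iff_of_eq (or_false _)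
  | resSwap P => exact (P.hasAct_sub_iff a fun k => Sess.sub_swapC_eq k p (i + 2)).symm
  | resPar P Q =>
    exact or_congr_right (Q.hasAct_sub_iff a fun k => Sess.sub_wkC_eq_succ k p i).symm
  | par _ _ ih ih' => exact or_congr (ih i) (ih' i)
  | res _ ih => exact ih (i + 1)
  | loc _ _ _ ih => exact ih i
  | _ => exact Iff.rfl

theorem Pol.dual_dual (p : Pol) : p.dual.dual = p := by cases p <;> rfl

theorem Cong.hasRedex_iff {P Q : Proc} (h : Cong P Q) (i : ℕ) :
    P.HasRedex i ↔ Q.HasRedex i := by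
  induction h generalizing i with
  | symm _ ih => exact (ih i).symm
  | trans _ _ ih ih' => exact (ih i).trans (ih' i)
  | parComm P Q =>
    have key : ∀ P Q : Proc, (Proc.par P Q).HasRedex i → (Proc.par Q P).HasRedex i := by
      rintro P Q (h | h | ⟨p, a, b, hab, ha, hb⟩)
      · exact .inr (.inl h)
      · exact .inl h
      · exact .inr (.inr ⟨p.dual, b, a, hab.symm, hb, by rwa [Pol.dual_dual]⟩)
    exact ⟨key P Q, key Q P⟩
  | parAssoc P Q R =>
    simp only [Proc.HasRedex, Proc.HasAct]
    grind
  | parNil P => simp [Proc.HasRedex, Proc.HasAct]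
  | resSwap P => exact (P.hasRedex_sub_iff fun p k => Sess.sub_swapC_eq k p (i + 2)).symm
  | resPar P Q =>
    simp only [Proc.HasRedex, Proc.HasAct,
      Q.hasRedex_sub_iff fun p k => Sess.sub_wkC_eq_succ k p i,
      Q.hasAct_sub_iff _ fun k => Sess.sub_wkC_eq_succ k _ i]
  | par h h' ih ih' => simp only [Proc.HasRedex, ih, ih', h.hasAct_iff, h'.hasAct_iff]
  | res _ ih => exact ih (i + 1)
  | loc _ _ _ ih => exact ih i
  | _ => exact Iff.rfl

theorem Cong.hasRestrictedRedex_iff {P Q : Proc} (h : Cong P Q) :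
    P.HasRestrictedRedex ↔ Q.HasRestrictedRedex := by
  induction h with
  | symm _ ih => exact ih.symm
  | trans _ _ ih ih' => exact ih.trans ih'
  | parComm P Q => exact or_comm
  | parAssoc P Q R => exact or_assoc
  | parNil P => exact iff_of_eq (or_false _)
  | resNil => simp [Proc.HasRestrictedRedex, Proc.HasRedex]
  | resSwap P =>
    simp only [Proc.HasRestrictedRedex, Proc.HasRedex, P.hasRestrictedRedex_sub_iff,
      P.hasRedex_sub_iff fun p k => Sess.sub_swapC_eq k p _]
    exact or_left_comm
  | resPar P Q =>
    -- The component entering the scope is weakened and cannot mention the channel, so extrusion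
    -- creates no redex on it.
    have h1 : ∀ p a, ¬ (Q.sub Sub.wkC).HasAct 0 p a := fun p a =>
      Q.not_hasAct_sub a fun k => Sess.sub_wkC_ne_zero k p
    have h2 : ¬ (Q.sub Sub.wkC).HasRedex 0 := fun h =>
      let ⟨p, a, h'⟩ := h.exists_hasAct
      h1 p a h'
    simp only [Proc.HasRestrictedRedex, Proc.HasRedex, Q.hasRestrictedRedex_sub_iff, h1, h2]
    simp [or_assoc]
  | resLoc l n P => exact Iff.rfl
  | par _ _ ih ih' => exact or_congr ih ih'
  | res h ih => exact or_congr (h.hasRedex_iff 0) ih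
  | loc _ _ _ ih => exact ih
  | _ => exact Iff.rfl

/-! ### Preservation of redexes by update actions -/

/-- This is what the membership conditions on prefix subjects in `Proc.WF` are for. It is applied in
contrapositive form: no endpoints, no active prefixes. -/
theorem Proc.WF.mem_use_of_hasAct {P : Proc} (h : P.WF) {i : ℕ} {p : Pol} {a : Act}
    (ha : P.HasAct i p a) : some (.chan p i) ∈ P.use := by
  induction P generalizing i with
  | par P Q ihP ihQ =>
    rcases ha with ha | ha
    · exact Multiset.mem_add.2 (.inl (ihP h.1 ha))
    · exact Multiset.mem_add.2 (.inr (ihQ h.2 ha))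
  | loc l n P ih => exact ih h.1 ha
  | res P ih => exact Multiset.mem_map.2 ⟨_, ih h ha, rfl⟩
  | send k es P | recv k n P | select k n P =>
    rw [← ha.1]
    exact h.2
  | sendSess k k' P =>
    rw [← ha.1]
    exact Multiset.mem_cons_of_mem h.2
  | recvSess k P =>
    rw [← ha.1]
    exact h.2.2
  | branch k m lab P =>
    rw [← ha.1]
    exact h.2
  | close k P =>
    rw [← ha.1]
    exact Multiset.mem_cons_self _ _
  | _ => exact ha.elim

theorem Proc.WF.mem_use_of_hasRestrictedRedex {P : Proc} (h : P.WF)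
    (hr : P.HasRestrictedRedex) : none ∈ P.use := by
  induction P with
  | par P Q ihP ihQ =>
    rcases hr with hr | hr
    · exact Multiset.mem_add.2 (.inl (ihP h.1 hr))
    · exact Multiset.mem_add.2 (.inr (ihQ h.2 hr))
  | loc l n P ih => exact ih h.1 hr
  | res P ih =>
    rcases hr with hr | hr
    · obtain ⟨p, a, ha⟩ := hr.exists_hasAct
      exact Multiset.mem_map.2 ⟨some (.chan p 0), Proc.WF.mem_use_of_hasAct (P := P) h ha, rfl⟩
    · exact Multiset.mem_map.2 ⟨none, ih h hr, rfl⟩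
  | _ => exact hr.elim

/-- `Q` contains all the actions and redexes of `P`. -/
structure Proc.Simulates (Q P : Proc) : Prop where
  act : ∀ i p a, P.HasAct i p a → Q.HasAct i p a
  redex : ∀ i, P.HasRedex i → Q.HasRedex i
  restricted : P.HasRestrictedRedex → Q.HasRestrictedRedex

/-- A redex may be formed across the two components; it survives because each of them keeps its
actions, not only its redexes. -/
theorem Proc.Simulates.par {P P' Q Q' : Proc} (h : P'.Simulates P) (h' : Q'.Simulates Q) :
    (Proc.par P' Q').Simulates (.par P Q) where
  act i p a := Or.imp (h.act i p a) (h'.act i p a)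
  redex i := Or.imp (h.redex i) (Or.imp (h'.redex i) fun ⟨p, a, b, hab, ha, hb⟩ =>
    ⟨p, a, b, hab, h.act _ _ _ ha, h'.act _ _ _ hb⟩)
  restricted := Or.imp h.restricted h'.restricted

theorem Proc.Simulates.refl (P : Proc) : P.Simulates P :=
  ⟨fun _ _ _ h => h, fun _ h => h, fun h => h⟩

theorem Proc.Simulates.fill {X Y : Proc} (h : Y.Simulates X) (C : Ctx) :
    (C.fill Y).Simulates (C.fill X) := by
  induction C with
  | hole => exact h
  | loc l n C P ih =>
    have := ih.par (Proc.Simulates.refl P)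
    exact ⟨this.act, this.redex, this.restricted⟩

/-- Vacuous: `X` has no action, and every redex, free or restricted, would need one. Hence `Y` is
arbitrary. -/
theorem Proc.simulates_of_use_eq_zero {X : Proc} (h : X.WF) (h0 : X.use = 0) (Y : Proc) :
    Y.Simulates X := by
  have hact : ∀ i p a, ¬ X.HasAct i p a := fun i p a ha => by
    have := h.mem_use_of_hasAct ha
    simp [h0] at this
  refine ⟨fun i p a ha => (hact i p a ha).elim, fun i hr => ?_, fun hr => ?_⟩
  · obtain ⟨p, a, ha⟩ := hr.exists_hasAct
    exact (hact i p a ha).elim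
  · have := h.mem_use_of_hasRestrictedRedex hr
    simp [h0] at this

theorem UpdRule.simulates {P Q : Proc} (h : UpdRule P Q) (hP : P.WF) : Q.Simulates P := by
  obtain ⟨E, C, D, l, P, Q⟩ := h
  obtain ⟨hC, hD⟩ := Ctx.wf_of_fill hP
  have hQ := Ctx.wf_of_fill hC
  have h0 : Q.use = 0 := Proc.use_eq_zero_of_loc hQ
  -- Both holes held processes that use nothing, so what replaces them is irrelevant.
  exact Proc.Simulates.fill (Proc.Simulates.par
    (Proc.Simulates.fill (Proc.simulates_of_use_eq_zero hQ h0 _) C)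
    (Proc.Simulates.fill (Proc.simulates_of_use_eq_zero (Ctx.wf_of_fill hD) rfl _) D)) E

theorem UpdRed.simulates {P Q : Proc} (h : UpdRed P Q) (hP : P.WF) : Q.Simulates P := by
  induction h with
  | base h => exact h.simulates hP
  | str h _ h' ih =>
    have hs := ih (h.wf_iff.1 hP)
    exact ⟨fun i p a ha => (h'.hasAct_iff i p a).1 (hs.act _ _ _ ((h.hasAct_iff i p a).1 ha)),
      fun i hr => (h'.hasRedex_iff i).1 (hs.redex _ ((h.hasRedex_iff i).1 hr)),
      fun hr => h'.hasRestrictedRedex_iff.1 (hs.restricted (h.hasRestrictedRedex_iff.1 hr))⟩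
  | par Q _ ih => exact (ih hP.1).par (Proc.Simulates.refl Q)
  | res _ ih =>
    have hs := ih hP
    -- A restricted redex is either on the channel bound here, free with index `0` in the body, or
    -- on one bound deeper.
    exact ⟨fun i => hs.act (i + 1), fun i => hs.redex (i + 1), Or.imp (hs.redex 0) hs.restricted⟩

/-! ### Update consistency -/

/-- The invariant ignores restrictions, so it passes to the body once they have been exposed at top
level; the same-channel clause of consistency then becomes the case of a free channel. -/
theorem Proc.wf_res_iterate (n : ℕ) (R : Proc) : (Proc.res^[n] R).WF ↔ R.WF := by
  induction n generalizing R with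
  | zero => exact Iff.rfl
  | succ n ih => exact ih (.res R)

theorem Proc.WF.updateConsistent {P : Proc} (hP : P.WF) : UpdateConsistent P := by
  intro P' h
  have hP' : P'.WF := by
    induction h with
    | refl => exact hP
    | tail _ h ih => exact Red.wf h ih
  exact ⟨fun κ _ hr h => (UpdRed.simulates h hP').redex κ hr,
    fun _ hr h => (UpdRed.simulates h hP').restricted hr,
    fun n R hc κ _ hr h =>
      (UpdRed.simulates h ((Proc.wf_res_iterate n R).1 (hc.wf_iff.1 hP'))).redex κ hr⟩

end AdaptableSessions

open AdaptableSessions in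
theorem theorem3 (Γ : Gamma) (Θ : Theta) (P : Proc) (Δ : Typing) (I : Interface)
    (hP : Typed Γ Θ P Δ I) (hΔ : Balanced Δ) : UpdateConsistent P :=
  hP.wf.updateConsistent
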